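/- Let $n\ge 3$ and $m\ge 4$ be integers. Let $G$ be the directed graph on $n+m$ nodes that consists of the undirected cycle on the nodes $c_0,\dots,c_{n-1}$, the undirected star on the nodes $s_0,\dots,s_{m-1}$ with hub $s_0$ (an undirected edge being a pair of opposite directed edges), and one directed edge from $c_0$ to $s_0$; all these edges have weight $1$. For $\overline\delta=(\delta_0,\dots,\delta_{m-1})$ with all $\delta_j\ge 0$, let $G_p$ be the graph obtained from $G$ by adding, for each $j$, a directed edge of weight $\delta_j$ from $s_j$ to $c_0$, and put $\delta=\delta_0+\cdots+\delta_{m-1}$. The Laplacian of a weighted digraph is $L=D-A$, where $A_{ij}$ is the weight of the edge from node $j$ to node $i$ and $D$ is the diagonal matrix with $D_{ii}=\sum_j A_{ij}$. Order the eigenvalues of $L$, repeated according to algebraic multiplicity, so that $\mathrm{Re}\,\lambda_1\le \mathrm{Re}\,\lambda_2\le\cdots$; then $\lambda_2(L)$ is the spectral gap. Put $$\alpha_l=2\Bigl(1-\cos\frac{l\pi}{n}\Bigr),\qquad \beta^{\pm}_{m,1}=\tfrac12\Bigl[m+1\pm\sqrt{(m+1)^2-4}\Bigr],$$ and assume that $\beta^-_{m,1}\notin\{\alpha_l: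 0\le l<n\}$. Then all eigenvalues of $L_G$ are real, and the following hold. (i) (Local modification) There is an $\varepsilon>0$ such that for every $\overline\delta\ne 0$ with $\delta<\varepsilon$ all eigenvalues of $L_{G_p}$ are real, and (a) if $\alpha_1<\beta^-_{m,1}$, then $\lambda_2(L_{G_p})<\lambda_2(L_G)$; (b) if $\beta^-_{m,1}<\alpha_1$, then $\lambda_2(L_{G_p})>\lambda_2(L_G)$. (ii) (Global modification) For every $\overline\delta\ne 0$: (a) if $\alpha_2<\beta^-_{m,1}$, then $\mathrm{Re}\,\lambda_2(L_{G_p})<\lambda_2(L_G)$; (b) if $\delta<\delta_0\,\beta^+_{m,1}$, then all eigenvalues of $L_{G_p}$ are real, and the statements (i)(a) and (i)(b) hold for this $\overline\delta$. -/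

import Mathlib

/-- `α_l = 2 (1 - cos (l π / n))`. -/
noncomputable def alpha (n l : ℕ) : ℝ :=
  2 * (1 - Real.cos (l * Real.pi / n))

/-- The smaller root of the quadratic polynomial `x ^ 2 - (m + w) x + w`. -/
noncomputable def betaMinus (m : ℕ) (w : ℝ) : ℝ :=
  1 / 2 * (m + w - Real.sqrt ((m + w) ^ 2 - 4 * w))

/-- The larger root of the quadratic polynomial `x ^ 2 - (m + w) x + w`. -/
noncomputable def betaPlus (m : ℕ) (w : ℝ) : ℝ :=
  1 / 2 * (m + w + Real.sqrt ((m + w) ^ 2 - 4 * w))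

/-- The Laplacian `D - A` of a weighted digraph. The entry `A i j` is the weight of the edge
that starts at `j` and ends at `i`, and `D` is the diagonal matrix of the in-degrees. -/
def digraphLaplacian {V : Type*} [Fintype V] [DecidableEq V] (A : Matrix V V ℝ) :
    Matrix V V ℝ :=
  Matrix.diagonal (fun i => ∑ j, A i j) - A

/-- The adjacency matrix of the unmodified graph `G`: the undirected cycle on the nodes `inl i`,
the undirected star on the nodes `inr j` (hub `inr 0`), and one directed cutset edge from the
cycle node `inl 0` to the hub; all these edges have weight `1`. -/
def adjG (n m : ℕ) [NeZero n] [NeZero m] : Matrix (Fin n ⊕ Fin m) (Fin n ⊕ Fin m) ℝ :=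
  Matrix.fromBlocks
    ((SimpleGraph.cycleGraph n).adjMatrix ℝ)
    0
    (Matrix.of fun j i => if j = 0 ∧ i = 0 then 1 else 0)
    ((SimpleGraph.starGraph (0 : Fin m)).adjMatrix ℝ)

/-- The adjacency matrix of the modification edges: for each node `j` of the star, one directed
edge of weight `δ j` from `inr j` to the cycle node `inl 0`. -/
def adjModification (n m : ℕ) [NeZero n] (δ : Fin m → ℝ) :
    Matrix (Fin n ⊕ Fin m) (Fin n ⊕ Fin m) ℝ :=
  Matrix.fromBlocks
    0
    (Matrix.of fun i j => if i = 0 then δ j else 0)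
    0
    0

/-- The Laplacian `L_G` of the unmodified graph. -/
def lapG (n m : ℕ) [NeZero n] [NeZero m] : Matrix (Fin n ⊕ Fin m) (Fin n ⊕ Fin m) ℝ :=
  digraphLaplacian (adjG n m)

/-- The Laplacian `L_{G_p} = L_G(δ)` of the modified graph. -/
def lapGp (n m : ℕ) [NeZero n] [NeZero m] (δ : Fin m → ℝ) :
    Matrix (Fin n ⊕ Fin m) (Fin n ⊕ Fin m) ℝ :=
  digraphLaplacian (adjG n m + adjModification n m δ)

/-- The complex eigenvalues of a real square matrix, with their algebraic multiplicities. -/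
noncomputable def eigenvalueMultiset {V : Type*} [Fintype V] [DecidableEq V]
    (A : Matrix V V ℝ) : Multiset ℂ :=
  A.charpoly.aroots ℂ

/-- All complex eigenvalues are real numbers. -/
def AllEigenvaluesReal {V : Type*} [Fintype V] [DecidableEq V] (A : Matrix V V ℝ) : Prop :=
  ∀ z ∈ eigenvalueMultiset A, z.im = 0

/-- `Re λ₂`: order the eigenvalues by their real parts,
`Re λ₁ ≤ Re λ₂ ≤ …`, repeated according to algebraic multiplicity, and take the real part
of the second one. If all eigenvalues are real, this is `λ₂` itself. (The default value `0` is
used only if there are fewer than two eigenvalues.) -/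
noncomputable def reLambda₂ {V : Type*} [Fintype V] [DecidableEq V] (A : Matrix V V ℝ) : ℝ :=
  (((eigenvalueMultiset A).map Complex.re).sort (· ≤ ·)).getD 1 0

/-!
Write `d = ∑ j, δ j` and let `F` be the monic polynomial `secularPoly n m d (δ 0)`. The new edges
all end at the node `c₀`, so a Schur complement with respect to the star block changes the cycle
pencil `x - L_cycle` only in its `(0, 0)` entry. The determinant of the cycle pencil
(`det_cyclePencil`, diagonalised by the discrete Fourier transform) and its `(0, 0)` cofactor
(`adjugate_cyclePencil`, diagonalised by sines) share the double cycle eigenvalues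
`α₂, α₄, … < 4`, and what remains is
`charpoly = x (x - 1) ^ (m - 2) ∏ (x - α₂ₖ) · F`  (`charpoly_lapGp`), where
`F = S B - T (d (x - (m + 1)) + δ₀)`, `S` has the simple roots `α₂, α₄, …` (including `αₙ` for even
`n`), `T` has the roots `α₁, α₃, …`, and `B = (x - β⁻) (x - β⁺)`. For `δ = 0` this gives
`λ₂(L_G) = min α₂ β⁻` (`reLambda₂_lapG`).

The roots `α₁ < α₂ < α₃ < …` of `T` and `S` interlace.

* If `α₁ < β⁻`, then `F` changes sign between `α₁` and `min α₂ β⁻`, for every `δ ≠ 0`, so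
  `λ₂` decreases (`reLambda₂_lapGp_lt`). No smallness of `δ` and no reality is needed.
* Let `W = (x - β⁻) (x - x₀) T`, where `4 < x₀ ≤ β⁺` and `F(x₀) < 0`. Interlacing shows that
  `F W'` is negative at every root of `W`, i.e. `F / W = 1 + ∑ cᵢ / (x - tᵢ)` with all `cᵢ < 0`.
  Such a function has no zeros off the real line, and none to the left of all the `tᵢ`
  (`im_eq_zero_of_eval_mul_derivative_nodal_neg`). Hence all eigenvalues are real, and if `β⁻ < α₁`
  all of them but the simple eigenvalue `0` exceed `β⁻` (`allEigenvaluesReal_lapGp_and_lt`).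

The point `x₀ = β⁺` is admissible when `d < δ₀ β⁺`, and the midpoint of `4` and `β⁺` is admissible
when `d` is small.
-/

open Polynomial Matrix

/-! ### Polynomials with negative residues against a nodal polynomial -/

/-- Let `W` be the nodal polynomial of the points `v i`. If the monic polynomial `F` has the same
degree as `W` and `F * W'` is negative at all nodes, then `F / W = 1 + ∑ cᵢ / (z - v i)` with all
`cᵢ < 0`. For `z` off the real line the imaginary part of the sum has the sign of `Im z`, and for
real `z` to the left of all nodes the sum is nonnegative; so all complex roots of `F` are real, and
each exceeds some node. -/
theorem im_eq_zero_of_eval_mul_derivative_nodal_neg {ι : Type*} [DecidableEq ι] {s : Finset ι}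
    {v : ι → ℝ} (hv : Set.InjOn v s) {F : ℝ[X]} (hF : F.Monic) (hdeg : F.natDegree = s.card)
    (hneg : ∀ i ∈ s, F.eval (v i) * (derivative (Lagrange.nodal s v)).eval (v i) < 0)
    {z : ℂ} (hz : aeval z F = 0) : z.im = 0 ∧ ∃ i ∈ s, v i < z.re := by
  set w : ι → ℂ := fun i => (v i : ℂ) with hw
  have hwinj : Set.InjOn w s := fun i hi j hj h => hv hi hj (Complex.ofReal_injective h)
  set c : ι → ℝ := fun i => Lagrange.nodalWeight s v i * F.eval (v i) with hc
  have hcneg : ∀ i ∈ s, c i < 0 := by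
    intro i hi
    have h := hneg i hi
    simp only [hc]
    rw [Lagrange.nodalWeight_eq_eval_derivative_nodal hi]
    have hne : (derivative (Lagrange.nodal s v)).eval (v i) ≠ 0 := by
      intro h0; simp [h0] at h
    have : (eval (v i) (derivative (Lagrange.nodal s v)))⁻¹ * eval (v i) F
      = (eval (v i) F * eval (v i) (derivative (Lagrange.nodal s v)))
        * ((eval (v i) (derivative (Lagrange.nodal s v)))⁻¹) ^ 2 := by
      field_simp
    rw [this]
    exact mul_neg_of_neg_of_pos h (by positivity)
  have hnode : ∀ i ∈ s, z ≠ w i := by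
    rintro i hi rfl
    have h := hneg i hi
    have : F.eval (v i) = 0 := by
      have h2 : aeval ((v i : ℝ) : ℂ) F = ((F.eval (v i) : ℝ) : ℂ) := by
        rw [← Complex.coe_algebraMap, aeval_algebraMap_apply]; simp
      rw [h2] at hz
      exact_mod_cast hz
    simp [this] at h
  set G : ℂ[X] := F.map (algebraMap ℝ ℂ) with hG
  have hGm : G.Monic := hF.map _
  have hGdeg : G.degree = s.card := by
    rw [degree_eq_natDegree hGm.ne_zero, hF.natDegree_map, hdeg]
  have hGW : G - Lagrange.nodal s w = Lagrange.interpolate s w fun i => ((F.eval (v i) : ℝ) : ℂ) := by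
    refine Lagrange.eq_interpolate_of_eval_eq _ hwinj ?_ ?_
    · rw [← hGdeg]
      refine degree_sub_lt_left ?_ hGm.ne_zero ?_
      · rw [hGdeg, Lagrange.degree_nodal]
      · rw [hGm.leadingCoeff, Lagrange.nodal_monic.leadingCoeff]
    · intro i hi
      rw [eval_sub, Lagrange.eval_nodal_at_node hi, sub_zero, hG, hw]
      simp only [eval_map_algebraMap]
      rw [← Complex.coe_algebraMap, aeval_algebraMap_apply]; simp
  have hweight : ∀ i, Lagrange.nodalWeight s w i = ((Lagrange.nodalWeight s v i : ℝ) : ℂ) := by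
    intro i; simp [Lagrange.nodalWeight, hw]
  have hsum : 1 + ∑ i ∈ s, (c i : ℂ) * (z - w i)⁻¹ = 0 := by
    have h1 : eval z (G - Lagrange.nodal s w) = - eval z (Lagrange.nodal s w) := by
      rw [eval_sub, hG, eval_map_algebraMap, hz, zero_sub]
    rw [hGW, Lagrange.eval_interpolate_not_at_node _ hnode] at h1
    have h2 : eval z (Lagrange.nodal s w) ≠ 0 := Lagrange.eval_nodal_not_at_node hnode
    have h3 : ∑ i ∈ s, Lagrange.nodalWeight s w i * (z - w i)⁻¹ * ((F.eval (v i) : ℝ) : ℂ) = -1 :=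
      mul_left_cancel₀ h2 (by rw [h1]; ring)
    rw [← h3.symm.trans (Finset.sum_congr rfl ?_)]
    · ring
    · intro i _
      rw [hweight]; simp only [hc]; push_cast; ring
  -- each term contributes a positive multiple of `z.im` to the imaginary part
  have him : z.im = 0 := by
    have h := congrArg Complex.im hsum
    simp only [Complex.add_im, Complex.one_im, Complex.im_sum, Complex.zero_im, zero_add,
      Complex.im_ofReal_mul, Complex.inv_im, Complex.sub_im] at h
    have h' : z.im * ∑ i ∈ s, (-c i / Complex.normSq (z - w i)) = 0 := by
      rw [← h, Finset.mul_sum]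
      refine Finset.sum_congr rfl fun i _ => ?_
      simp only [hw, Complex.ofReal_im, sub_zero]; ring
    rcases mul_eq_zero.1 h' with h0 | h0
    · exact h0
    · exfalso
      have hpos : ∀ i ∈ s, 0 < -c i / Complex.normSq (z - w i) := fun i hi =>
        div_pos (neg_pos.2 (hcneg i hi)) (Complex.normSq_pos.2 (sub_ne_zero.2 (hnode i hi)))
      rcases s.eq_empty_or_nonempty with rfl | hs
      · simp at hsum
      · exact (Finset.sum_pos hpos hs).ne' h0
  refine ⟨him, ?_⟩
  by_contra! hcon
  have h := congrArg Complex.re hsum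
  simp only [Complex.add_re, Complex.one_re, Complex.re_sum, Complex.zero_re,
      Complex.re_ofReal_mul, Complex.inv_re, Complex.sub_re] at h
  have : 0 ≤ ∑ i ∈ s, c i * ((z.re - (w i).re) / Complex.normSq (z - w i)) :=
    Finset.sum_nonneg fun i hi => mul_nonneg_of_nonpos_of_nonpos (hcneg i hi).le
      (div_nonpos_of_nonpos_of_nonneg (by simpa [hw] using hcon i hi) (Complex.normSq_nonneg _))
  linarith

/-! ### The second smallest element of a multiset -/

theorem Multiset.sort_getD_one_lt {s : Multiset ℝ} {a b c : ℝ} (h : a ::ₘ {b} ≤ s)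
    (ha : a < c) (hb : b < c) : (s.sort (· ≤ ·)).getD 1 0 < c := by
  by_contra! hcon
  have hcard : 2 ≤ (s.filter (· < c)).card := by
    have := Multiset.card_le_card (Multiset.le_filter.2 ⟨h, by simp [ha, hb]⟩ : a ::ₘ {b} ≤ s.filter (· < c))
    simpa using this
  have hsorted := Multiset.pairwise_sort s (· ≤ ·)
  rw [← Multiset.sort_eq s (· ≤ ·)] at hcard
  match hl : s.sort (· ≤ ·) with
  | [] => simp [hl] at hcard
  | [x] =>
    have := Multiset.card_le_card (Multiset.filter_le (· < c) (↑(s.sort (· ≤ ·)) : Multiset ℝ))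
    simp only [hl, Multiset.coe_card, List.length_singleton] at this hcard
    omega
  | x :: y :: t =>
    simp only [hl, List.getD_cons_succ, List.getD_cons_zero] at hcon hcard hsorted
    have hempty : ((y :: t).filter (fun u => decide (u < c))) = [] := by
      rw [List.filter_eq_nil_iff]
      intro u hu
      have : y ≤ u := by
        rcases List.mem_cons.1 hu with rfl | hu
        · exact le_rfl
        · exact (List.pairwise_cons.1 (List.pairwise_cons.1 hsorted).2).1 u hu
      simpa using hcon.trans this
    rw [Multiset.filter_coe, Multiset.coe_card, List.filter_cons, hempty] at hcard
    split_ifs at hcard <;> simp at hcard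

theorem Multiset.sort_getD_one_cons {s : Multiset ℝ} {a : ℝ} (h : ∀ b ∈ s, a ≤ b) (hs : s ≠ 0) :
    ((a ::ₘ s).sort (· ≤ ·)).getD 1 0 ∈ s := by
  rw [Multiset.sort_cons _ _ _ h, List.getD_cons_succ]
  have hlen : 0 < (s.sort (· ≤ ·)).length := by
    rw [Multiset.length_sort]; exact Multiset.card_pos.2 hs
  rw [List.getD_eq_getElem _ _ hlen]
  exact (Multiset.mem_sort _).1 (List.getElem_mem hlen)

theorem Multiset.sort_getD_one_eq {s : Multiset ℝ} {a c : ℝ} (hac : a ≤ c) (hc : c ∈ s)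
    (h : ∀ b ∈ s, c ≤ b) : ((a ::ₘ s).sort (· ≤ ·)).getD 1 0 = c := by
  obtain ⟨t, rfl⟩ := Multiset.exists_cons_of_mem hc
  rw [Multiset.sort_cons _ _ _ fun b hb => hac.trans (h b hb),
    Multiset.sort_cons _ _ _ fun b hb => h b (Multiset.mem_cons_of_mem hb)]
  simp

/-! ### The pencil of the cycle -/

/-- The matrix `x - L` for the Laplacian `L = 2 - A` of the undirected cycle on `n ≥ 3` nodes. -/
def cyclePencil (K : Type*) [Field K] (n : ℕ) (x : K) : Matrix (Fin n) (Fin n) K :=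
  (x - 2) • 1 + (SimpleGraph.cycleGraph n).adjMatrix K

theorem cyclePencil_mulVec {K : Type*} [Field K] {k : ℕ} (x : K) (v : Fin (k + 3) → K)
    (i : Fin (k + 3)) :
    (cyclePencil K (k + 3) x *ᵥ v) i = (x - 2) * v i + (v (i - 1) + v (i + 1)) := by
  rw [cyclePencil, Matrix.add_mulVec, Pi.add_apply, SimpleGraph.adjMatrix_mulVec_apply,
    SimpleGraph.cycleGraph_neighborFinset, Finset.sum_pair, Matrix.smul_mulVec, Matrix.one_mulVec,
    Pi.smul_apply, smul_eq_mul]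
  simp only [ne_eq, sub_eq_iff_eq_add, add_assoc i, left_eq_add]
  exact ne_of_beq_false rfl

theorem pow_val_add_one {K : Type*} [Field K] {k : ℕ} {η : K} (hη : η ^ (k + 3) = 1)
    (i : Fin (k + 3)) : η ^ ((i + 1 : Fin (k + 3)) : ℕ) = η ^ (i : ℕ) * η := by
  rw [Fin.val_add, ← pow_eq_pow_mod _ hη, pow_add]
  simp

/-- The Fourier vectors `j ↦ ζ ^ (j l)` diagonalise the cycle pencil over `ℂ`; they are linearly
independent because their matrix is a transposed Vandermonde matrix. -/
theorem det_cyclePencil {n : ℕ} (hn : 3 ≤ n) (x : ℝ) :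
    (cyclePencil ℝ n x).det = ∏ k ∈ Finset.range n, (x - alpha n (2 * k)) := by
  obtain ⟨k, rfl⟩ := Nat.exists_eq_add_of_le' hn
  set ζ : ℂ := Complex.exp (2 * Real.pi * Complex.I / (k + 3 : ℕ)) with hζ
  have hprim : IsPrimitiveRoot ζ (k + 3) := Complex.isPrimitiveRoot_exp _ (by omega)
  set V : Matrix (Fin (k + 3)) (Fin (k + 3)) ℂ :=
    (Matrix.vandermonde fun l : Fin (k + 3) => ζ ^ (l : ℕ)).transpose with hV
  have hVdet : V.det ≠ 0 := by
    rw [hV, Matrix.det_transpose, Matrix.det_vandermonde_ne_zero_iff]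
    intro i j hij
    exact Fin.ext (hprim.pow_inj i.2 j.2 hij)
  have hα : ∀ l : ℕ, ((alpha (k + 3) (2 * l) : ℝ) : ℂ) = 2 - (ζ ^ l)⁻¹ - ζ ^ l := by
    intro l
    have : ζ ^ l = Complex.exp (((2 * l * Real.pi / (k + 3 : ℕ) : ℝ) : ℂ) * Complex.I) := by
      rw [hζ, ← Complex.exp_nat_mul]; congr 1; push_cast; ring
    rw [this, ← Complex.exp_neg, alpha]
    push_cast
    rw [Complex.cos]
    ring_nf
  have hmul : cyclePencil ℂ (k + 3) x * V =
      V * Matrix.diagonal fun l : Fin (k + 3) => (x : ℂ) - (alpha (k + 3) (2 * l) : ℝ) := by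
    ext i l
    have hη : (ζ ^ (l : ℕ)) ^ (k + 3) = 1 := by
      rw [← pow_mul, mul_comm, pow_mul, hprim.pow_eq_one, one_pow]
    have hη0 : ζ ^ (l : ℕ) ≠ 0 := pow_ne_zero _ (hprim.ne_zero (by omega))
    have h1 := cyclePencil_mulVec (x : ℂ) (fun j : Fin (k + 3) => (ζ ^ (l : ℕ)) ^ (j : ℕ)) i
    have h2 := pow_val_add_one hη i
    have h3 := pow_val_add_one hη (i - 1)
    rw [sub_add_cancel] at h3
    rw [Matrix.mul_diagonal, hα]
    change (cyclePencil ℂ (k + 3) x *ᵥ fun j : Fin (k + 3) => (ζ ^ (l : ℕ)) ^ (j : ℕ)) i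
      = (ζ ^ (l : ℕ)) ^ (i : ℕ) * _
    rw [h1]
    rw [h2, h3]
    field_simp
    ring
  have hdet : (cyclePencil ℂ (k + 3) x).det =
      ∏ l : Fin (k + 3), ((x : ℂ) - (alpha (k + 3) (2 * l) : ℝ)) := by
    have := congrArg Matrix.det hmul
    rw [Matrix.det_mul, Matrix.det_mul, Matrix.det_diagonal, mul_comm] at this
    exact mul_left_cancel₀ hVdet this
  have hmap : cyclePencil ℂ (k + 3) x = (cyclePencil ℝ (k + 3) x).map (algebraMap ℝ ℂ) := by
    ext i j
    simp only [cyclePencil, Matrix.map_apply, Matrix.add_apply, Matrix.smul_apply,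
      SimpleGraph.adjMatrix_apply, Matrix.one_apply]
    split_ifs <;> simp
  rw [hmap, ← RingHom.mapMatrix_apply, ← RingHom.map_det] at hdet
  rw [Finset.prod_range]
  apply Complex.ofReal_injective
  rw [← Complex.coe_algebraMap, hdet]
  simp

theorem alpha_strictMonoOn (n : ℕ) : StrictMonoOn (alpha n) (Set.Iic n) := by
  intro i hi j hj hij
  have hn : (0 : ℝ) < n := by exact_mod_cast (Nat.zero_le i).trans_lt (hij.trans_le hj)
  have hmem : ∀ l ∈ Set.Iic n, (l * Real.pi / n : ℝ) ∈ Set.Icc 0 Real.pi := by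
    intro l hl
    have hl' : (l : ℝ) ≤ n := by exact_mod_cast hl
    refine ⟨by positivity, ?_⟩
    rw [div_le_iff₀ hn, mul_comm]
    exact mul_le_mul_of_nonneg_left hl' Real.pi_pos.le
  have h := Real.strictAntiOn_cos (hmem i hi) (hmem j hj) (by
    have : (i : ℝ) < j := by exact_mod_cast hij
    gcongr)
  simp only [alpha]
  linarith

/-- The Fourier modes `k` and `n - k` of the cycle have the same eigenvalue. -/
theorem alpha_two_mul_sub {n k : ℕ} (hn : 0 < n) (hk : k ≤ n) :
    alpha n (2 * (n - k)) = alpha n (2 * k) := by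
  have hn' : (n : ℝ) ≠ 0 := by positivity
  rw [alpha, alpha]
  congr 2
  rw [← Real.cos_two_pi_sub]
  congr 1
  push_cast [Nat.cast_sub hk]
  field_simp
  ring

/-- The `(0, 0)` cofactor of the cycle pencil is the characteristic polynomial of the cycle Laplacian
with node `0` deleted. That matrix has size `n - 1`, and the sine vectors `j ↦ sin (j l π / n)`, which
vanish at node `0`, provide `n - 1` distinct eigenvalues `α₁, …, αₙ₋₁`. -/
theorem adjugate_cyclePencil {n : ℕ} [NeZero n] (hn : 3 ≤ n) (x : ℝ) :
    (cyclePencil ℝ n x).adjugate 0 0 = ∏ l ∈ Finset.range (n - 1), (x - alpha n (l + 1)) := by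
  obtain ⟨k, rfl⟩ := Nat.exists_eq_add_of_le' hn
  set M : Matrix (Fin (k + 2)) (Fin (k + 2)) ℝ := Matrix.scalar _ 2 -
    ((SimpleGraph.cycleGraph (k + 3)).adjMatrix ℝ).submatrix Fin.succ Fin.succ with hM
  have hadj : ∀ y : ℝ, (cyclePencil ℝ (k + 3) y).adjugate 0 0 = M.charpoly.eval y := by
    intro y
    rw [Matrix.adjugate_fin_succ_eq_det_submatrix, Matrix.eval_charpoly]
    simp only [Fin.val_zero, add_zero, pow_zero, one_mul]
    congr 1
    ext i j
    by_cases hij : i = j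
    · simp [hM, hij, cyclePencil, SimpleGraph.adjMatrix_apply]
    · simp [hM, hij, cyclePencil, SimpleGraph.adjMatrix_apply]
  have hinj : Set.InjOn (fun l => alpha (k + 3) (l + 1)) (Finset.range (k + 2)) := by
    intro i hi j hj hij
    have := (alpha_strictMonoOn (k + 3)).injOn (x₁ := i + 1) (x₂ := j + 1)
      (by simp at hi ⊢; omega) (by simp at hj ⊢; omega) hij
    omega
  have hroot : ∀ l ∈ Finset.range (k + 2), M.charpoly.eval (alpha (k + 3) (l + 1)) = 0 := by
    intro l hl
    rw [Finset.mem_range] at hl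
    rw [← hadj, Matrix.adjugate_apply, ← Matrix.exists_mulVec_eq_zero_iff]
    set θ : ℝ := (l + 1 : ℕ) * Real.pi / (k + 3 : ℕ) with hθ
    have hθn : θ * (k + 3 : ℕ) = (l + 1 : ℕ) * Real.pi := by
      rw [hθ]; field_simp
    refine ⟨fun j => Real.sin (θ * (j : ℕ)), fun h0 => ?_, ?_⟩
    · have h1 := congrFun h0 1
      have hpos : 0 < Real.sin θ := by
        apply Real.sin_pos_of_pos_of_lt_pi
        · have := Real.pi_pos
          positivity
        · rw [hθ, div_lt_iff₀ (by positivity), mul_comm]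
          have : ((l + 1 : ℕ) : ℝ) < (k + 3 : ℕ) := by exact_mod_cast (by omega)
          exact mul_lt_mul_of_pos_left this Real.pi_pos
      simp only [Fin.val_one, Nat.cast_one, mul_one, Pi.zero_apply] at h1
      exact hpos.ne' h1
    · ext i
      by_cases hi : i = 0
      · subst hi
        simp [Matrix.mulVec]
      · rw [Matrix.mulVec, Matrix.updateRow_ne hi]
        change (cyclePencil ℝ (k + 3) _ *ᵥ _) i = 0
        rw [cyclePencil_mulVec]
        have hi0 : (i : ℕ) ≠ 0 := fun h => hi (Fin.ext h)
        have h1 : (((i - 1 : Fin (k + 3)) : ℕ) : ℝ) = (i : ℕ) - 1 := by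
          rw [Fin.val_sub_one_of_ne_zero hi, Nat.cast_sub (by omega), Nat.cast_one]
        have h2 : Real.sin (θ * ((i + 1 : Fin (k + 3)) : ℕ)) = Real.sin (θ * ((i : ℕ) + 1)) := by
          rw [Fin.val_add_one]
          -- the neighbour of the last node is node `0`, where `sin (n θ) = 0` as well
          split_ifs with hlast
          · have : (((i : ℕ) : ℝ) + 1) = (k + 3 : ℕ) := by
              rw [hlast]; simp; ring
            rw [this, hθn, Real.sin_nat_mul_pi]; simp
          · push_cast; rfl
        have hα : alpha (k + 3) (l + 1) = 2 - 2 * Real.cos θ := by rw [alpha, hθ]; ring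
        rw [h1, h2, hα, mul_sub, mul_add, mul_one, Real.sin_sub, Real.sin_add]
        ring
  have hpoly : M.charpoly = Lagrange.nodal (Finset.range (k + 2))
      (fun l => alpha (k + 3) (l + 1)) := by
    refine eq_of_degree_le_of_eval_index_eq _ hinj ?_ ?_ ?_ ?_
    · rw [Matrix.charpoly_degree_eq_dim]; simp
    · rw [Matrix.charpoly_degree_eq_dim, Lagrange.degree_nodal]; simp
    · rw [(Matrix.charpoly_monic M).leadingCoeff, Lagrange.nodal_monic.leadingCoeff]
    · intro l hl
      rw [hroot l hl]; exact (Lagrange.eval_nodal_at_node (v := fun l => alpha (k + 3) (l + 1)) hl).symm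
  rw [hadj, hpoly, Lagrange.eval_nodal]
  rfl

/-! ### The characteristic polynomial of the modified Laplacian -/

/-- The matrix `x - L` for the star block of the Laplacian of `G`; because of the cutset edge, the
in-degree of the hub `0` is `m` instead of `m - 1`. -/
noncomputable def starPencil (m : ℕ) [NeZero m] (x : ℝ) : Matrix (Fin m) (Fin m) ℝ :=
  Matrix.of fun i j =>
    if i = j then (if i = 0 then x - m else x - 1) else if i = 0 ∨ j = 0 then 1 else 0

/-- The polynomial `x ^ 2 - (m + 1) x + 1`, whose roots are `betaMinus m 1` and `betaPlus m 1`. -/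
noncomputable def starQuadratic (m : ℕ) : ℝ[X] := X ^ 2 - C (m + 1 : ℝ) * X + 1

/-- The hub column of the adjugate of the star pencil, up to a power of `x - 1`. -/
theorem starPencil_mulVec {m : ℕ} [NeZero m] (x : ℝ) :
    starPencil m x *ᵥ (fun j => if j = 0 then x - 1 else -1) =
      Pi.single 0 ((starQuadratic m).eval x) := by
  obtain ⟨k, rfl⟩ := Nat.exists_eq_succ_of_ne_zero (NeZero.ne m)
  ext i
  refine Fin.cases ?_ (fun i => ?_) i
  · simp [Matrix.mulVec, dotProduct, Fin.sum_univ_succ, starPencil, starQuadratic,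
      Fin.succ_ne_zero, (Fin.succ_ne_zero _).symm]
    ring
  · simp [Matrix.mulVec, dotProduct, Fin.sum_univ_succ, starPencil,
      Fin.succ_ne_zero]

theorem det_starPencil {m : ℕ} [NeZero m] (hm : 2 ≤ m) {x : ℝ} (hx : x ≠ 1) :
    (starPencil m x).det = (x - 1) ^ (m - 2) * (starQuadratic m).eval x := by
  obtain ⟨k, rfl⟩ := Nat.exists_eq_add_of_le' hm
  have h := congrFun (congrArg ((starPencil (k + 2) x).adjugate *ᵥ ·) (starPencil_mulVec x)) 0
  have hminor : (starPencil (k + 2) x).adjugate 0 0 = (x - 1) ^ (k + 1) := by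
    have : (starPencil (k + 2) x).submatrix Fin.succ Fin.succ =
        Matrix.diagonal fun _ : Fin (k + 1) => x - 1 := by
      ext i j
      simp [starPencil, Matrix.diagonal_apply, Fin.succ_ne_zero]
    rw [Matrix.adjugate_fin_succ_eq_det_submatrix]
    simp only [Fin.val_zero, add_zero, pow_zero, one_mul]
    change ((starPencil (k + 2) x).submatrix Fin.succ Fin.succ).det = _
    rw [this, Matrix.det_diagonal]
    simp
  simp only [Matrix.mulVec_mulVec, Matrix.adjugate_mul, Matrix.smul_mulVec, Matrix.one_mulVec,
    Matrix.mulVec_single, Pi.smul_apply, if_true, smul_eq_mul, Matrix.col_apply, hminor,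
    MulOpposite.smul_eq_mul_unop, MulOpposite.unop_op] at h
  apply mul_right_cancel₀ (sub_ne_zero.2 hx)
  rw [h]
  simp only [Nat.add_sub_cancel]
  ring

/-- The determinant is affine in the `(0, 0)` entry. -/
theorem det_cyclePencil_sub_single {n : ℕ} [NeZero n] (x t : ℝ) :
    (cyclePencil ℝ n x - Matrix.single 0 0 t).det =
      (cyclePencil ℝ n x).det - t * (cyclePencil ℝ n x).adjugate 0 0 := by
  set A := cyclePencil ℝ n x
  have h : A - Matrix.single 0 0 t = A.updateRow 0 (A 0 + (-t) • Pi.single 0 1) := by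
    ext i j
    by_cases hi : i = 0
    · subst hi
      by_cases hj : j = 0
      · subst hj
        simp [sub_eq_add_neg]
      · simp [hj, Ne.symm hj]
    · simp [Matrix.updateRow_ne hi, Ne.symm hi]
  rw [h, Matrix.det_updateRow_add, Matrix.det_updateRow_smul, Matrix.updateRow_eq_self,
    Matrix.adjugate_apply]
  ring

/-- The block form of `x - L_{G_p}`. The Laplacian has the off-diagonal entries `-A i j`, so the
edges between cycle and star enter with a positive sign. -/
theorem scalar_sub_lapGp {n m : ℕ} [NeZero n] [NeZero m] (hn : 3 ≤ n) (hm : 2 ≤ m)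
    (δ : Fin m → ℝ) (x : ℝ) :
    Matrix.scalar _ x - lapGp n m δ =
      Matrix.fromBlocks (cyclePencil ℝ n x - Matrix.single 0 0 (∑ j, δ j))
        (Matrix.of fun i j => if i = 0 then δ j else 0)
        (Matrix.of fun j i => if j = 0 ∧ i = 0 then 1 else 0) (starPencil m x) := by
  have hdeg : ∀ i : Fin n, ∑ j, (SimpleGraph.cycleGraph n).adjMatrix ℝ i j = 2 := by
    obtain ⟨k, rfl⟩ := Nat.exists_eq_add_of_le' hn
    intro i
    have h := SimpleGraph.adjMatrix_mulVec_const_apply (G := SimpleGraph.cycleGraph (k + 3))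
      (a := (1 : ℝ)) (v := i)
    rw [SimpleGraph.cycleGraph_degree_three_le] at h
    simp only [Matrix.mulVec, dotProduct, Function.const_apply, mul_one] at h
    exact_mod_cast h
  have hstar : ∀ i : Fin m, ∑ j, (SimpleGraph.starGraph (0 : Fin m)).adjMatrix ℝ i j =
      if i = 0 then (m : ℝ) - 1 else 1 := by
    obtain ⟨k, rfl⟩ := Nat.exists_eq_succ_of_ne_zero (NeZero.ne m)
    intro i
    rw [Fin.sum_univ_succ]
    refine Fin.cases ?_ (fun i => ?_) i
    · simp [SimpleGraph.adjMatrix_apply, (Fin.succ_ne_zero _).symm]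
    · simp [SimpleGraph.adjMatrix_apply, Fin.succ_ne_zero]
  have hrow₁ : ∀ i : Fin n, ∑ j, (adjG n m + adjModification n m δ) (Sum.inl i) j =
      2 + if i = 0 then ∑ j, δ j else 0 := by
    intro i
    rw [Fintype.sum_sum_type]
    simp only [adjG, adjModification, Matrix.add_apply, Matrix.fromBlocks_apply₁₁,
      Matrix.fromBlocks_apply₁₂, Matrix.zero_apply, Matrix.of_apply, add_zero, zero_add, hdeg]
    split_ifs <;> simp
  have hrow₂ : ∀ i : Fin m, ∑ j, (adjG n m + adjModification n m δ) (Sum.inr i) j =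
      if i = 0 then (m : ℝ) else 1 := by
    intro i
    rw [Fintype.sum_sum_type]
    simp only [adjG, adjModification, Matrix.add_apply, Matrix.fromBlocks_apply₂₁,
      Matrix.fromBlocks_apply₂₂, Matrix.zero_apply, Matrix.of_apply, add_zero, hstar]
    split_ifs with hi <;> simp [hi]
  ext (i | i) (j | j)
  · rw [lapGp, digraphLaplacian, Matrix.sub_apply, Matrix.sub_apply, Matrix.diagonal_apply, hrow₁]
    by_cases hij : i = j
    · subst hij
      by_cases hi : i = 0
      · subst hi
        simp [adjG, adjModification, cyclePencil]
        ring
      · simp [adjG, adjModification, cyclePencil, hi, Ne.symm hi]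
    · have : ¬ (0 = i ∧ 0 = j) := fun h => hij (h.1.symm.trans h.2)
      simp [adjG, adjModification, cyclePencil, hij, this]
  · simp [lapGp, digraphLaplacian, adjG, adjModification]
  · simp [lapGp, digraphLaplacian, adjG, adjModification]
  · rw [lapGp, digraphLaplacian, Matrix.sub_apply, Matrix.sub_apply, Matrix.diagonal_apply, hrow₂]
    by_cases hij : i = j
    · subst hij
      by_cases hi : i = 0 <;> simp [adjG, adjModification, starPencil, hi]
    · simp [adjG, adjModification, starPencil, hij, SimpleGraph.adjMatrix_apply]

/-- The Schur complement with respect to the star block, at points where that block is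
invertible. -/
theorem eval_charpoly_lapGp {n m : ℕ} [NeZero n] [NeZero m] (hn : 3 ≤ n) (hm : 2 ≤ m)
    (δ : Fin m → ℝ) {x : ℝ} (hx : x ≠ 1) (hB : (starQuadratic m).eval x ≠ 0) :
    (lapGp n m δ).charpoly.eval x = (x - 1) ^ (m - 2) *
      ((starQuadratic m).eval x * (cyclePencil ℝ n x).det -
        x * ((∑ j, δ j) * (x - (m + 1)) + δ 0) * (cyclePencil ℝ n x).adjugate 0 0) := by
  set B := (starQuadratic m).eval x with hBdef
  have hdet := det_starPencil (m := m) hm hx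
  have hunit : IsUnit (starPencil m x).det := by
    rw [hdet, isUnit_iff_ne_zero]
    exact mul_ne_zero (pow_ne_zero _ (sub_ne_zero.2 hx)) hB
  let _ := (starPencil m x).invertibleOfIsUnitDet hunit
  set Cm : Matrix (Fin m) (Fin n) ℝ := Matrix.of fun j i => if j = 0 ∧ i = 0 then 1 else 0 with hC
  set u : Fin m → ℝ := fun j => if j = 0 then x - 1 else -1 with hu
  have hinv : ⅟(starPencil m x) * Cm =
      Matrix.of fun j i => if i = 0 then u j / B else 0 := by
    have : starPencil m x * (Matrix.of fun j (i : Fin n) => if i = 0 then u j / B else 0) = Cm := by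
      ext j i
      have h := congrFun (starPencil_mulVec (m := m) x) j
      simp only [Matrix.mulVec, dotProduct] at h
      by_cases hi : i = 0
      · simp only [Matrix.mul_apply, Matrix.of_apply, hi, if_true, hC, and_true, mul_div_assoc']
        rw [← Finset.sum_div, h, ← hBdef]
        by_cases hj : j = 0
        · subst hj; simp [hB]
        · simp [hj]
      · simp [Matrix.mul_apply, hi, hC]
    rw [← this, Matrix.invOf_mul_cancel_left]
  have hdot : ∑ j, δ j * u j = δ 0 * x - ∑ j, δ j := by
    have : ∀ j, δ j * u j = (if j = 0 then δ 0 * x else 0) - δ j := by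
      intro j
      by_cases hj : j = 0
      · subst hj; simp [hu]; ring
      · simp [hu, hj]
    simp [this, Finset.sum_sub_distrib]
  rw [Matrix.eval_charpoly, scalar_sub_lapGp hn hm, Matrix.det_fromBlocks₂₂, Matrix.mul_assoc, hinv]
  have hprod : (Matrix.of fun (i : Fin n) j => if i = 0 then δ j else 0) *
      (Matrix.of fun j (i : Fin n) => if i = 0 then u j / B else 0) =
      Matrix.single 0 0 ((δ 0 * x - ∑ j, δ j) / B) := by
    ext i j
    by_cases hi : i = 0
    · by_cases hj : j = 0
      · simp [Matrix.mul_apply, hi, hj, mul_div_assoc', ← Finset.sum_div, hdot]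
      · simp [Matrix.mul_apply, hi, hj, Ne.symm hj]
    · simp [Matrix.mul_apply, hi, Ne.symm hi]
  rw [hprod, sub_sub, ← Matrix.single_add, det_cyclePencil_sub_single, hdet, ← hBdef]
  have hB' : B = x ^ 2 - (m + 1) * x + 1 := by rw [hBdef]; simp [starQuadratic]
  field_simp
  rw [hB']
  ring

/-- The polynomial with the simple roots `α₂, α₄, …, α_{2 ⌊n/2⌋}`: the distinct nonzero eigenvalues of
the cycle. -/
noncomputable def evenCycleFactor (n : ℕ) : ℝ[X] := ∏ k ∈ Finset.range (n / 2), (X - C (alpha n (2 * k + 2)))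

/-- The polynomial with the simple roots `α_{2k}`, `0 < 2k < n`: the double eigenvalues of the cycle,
which remain eigenvalues after deleting a node. -/
noncomputable def doubleCycleFactor (n : ℕ) : ℝ[X] :=
  ∏ k ∈ Finset.range ((n - 1) / 2), (X - C (alpha n (2 * k + 2)))

/-- The polynomial with the simple roots `α₁, α₃, …, α_{2 ⌊n/2⌋ - 1}`: the eigenvalues of the
cycle Laplacian with a node deleted that are not eigenvalues of the cycle. -/
noncomputable def oddPathFactor (n : ℕ) : ℝ[X] :=
  Lagrange.nodal (Finset.range (n / 2)) fun k => alpha n (2 * k + 1)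

/-- The factor of the characteristic polynomial of the modified Laplacian that depends on the
modification; `d` is the total weight of the new edges and `d₀` the weight of the one that starts at
the hub. -/
noncomputable def secularPoly (n m : ℕ) (d d₀ : ℝ) : ℝ[X] :=
  evenCycleFactor n * starQuadratic m -
    oddPathFactor n * (C d * (X - C (m + 1 : ℝ)) + C d₀)

/-- The modes `k` and `n - k` are paired, so the nonzero double eigenvalues appear once in each of the
two factors. -/
theorem det_cyclePencil_eq {n : ℕ} (hn : 3 ≤ n) (x : ℝ) :
    (cyclePencil ℝ n x).det =
      x * (doubleCycleFactor n).eval x * (evenCycleFactor n).eval x := by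
  rw [det_cyclePencil hn, doubleCycleFactor, evenCycleFactor, eval_prod, eval_prod]
  have hsplit : n = 1 + (n - 1) / 2 + n / 2 := by omega
  have h0 : alpha n (2 * 0) = 0 := by simp [alpha]
  conv_lhs => rw [show Finset.range n = Finset.range (1 + (n - 1) / 2 + n / 2) by rw [← hsplit]]
  rw [Finset.prod_range_add, Finset.prod_range_add, Finset.prod_range_one, h0, sub_zero]
  congr 1
  · congr 1
    refine Finset.prod_congr rfl fun k _ => ?_
    rw [show 2 * (1 + k) = 2 * k + 2 by ring]
    simp
  · rw [← Finset.prod_range_reflect]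
    refine Finset.prod_congr rfl fun k hk => ?_
    rw [Finset.mem_range] at hk
    rw [show 1 + (n - 1) / 2 + (n / 2 - 1 - k) = n - (k + 1) by omega,
      alpha_two_mul_sub (by omega) (by omega)]
    simp [mul_add]

theorem prod_range_odd_even (f : ℕ → ℝ) (N : ℕ) :
    ∏ l ∈ Finset.range N, f (l + 1) =
      (∏ k ∈ Finset.range (N / 2), f (2 * k + 2)) *
        ∏ k ∈ Finset.range ((N + 1) / 2), f (2 * k + 1) := by
  induction N using Nat.twoStepInduction with
  | zero => simp
  | one => simp
  | more N ih _ =>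
    rw [Finset.prod_range_succ, Finset.prod_range_succ, ih,
      show (N + 2) / 2 = N / 2 + 1 by omega, show (N + 2 + 1) / 2 = (N + 1) / 2 + 1 by omega,
      Finset.prod_range_succ, Finset.prod_range_succ]
    rcases Nat.even_or_odd' N with ⟨k, rfl | rfl⟩
    · rw [show 2 * k / 2 = k by omega, show (2 * k + 1) / 2 = k by omega]; ring
    · rw [show (2 * k + 1) / 2 = k by omega, show (2 * k + 1 + 1) / 2 = k + 1 by omega,
        show 2 * (k + 1) + 1 = 2 * k + 1 + 1 + 1 by ring]; ring

theorem adjugate_cyclePencil_eq {n : ℕ} [NeZero n] (hn : 3 ≤ n) (x : ℝ) :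
    (cyclePencil ℝ n x).adjugate 0 0 =
      (doubleCycleFactor n).eval x * (oddPathFactor n).eval x := by
  rw [adjugate_cyclePencil hn, prod_range_odd_even (fun l => x - alpha n l), doubleCycleFactor,
    oddPathFactor, eval_prod, Lagrange.eval_nodal, show n - 1 + 1 = n by omega]
  simp

/-- The formula of `eval_charpoly_lapGp` holds at all but finitely many points, hence identically. -/
theorem charpoly_lapGp {n m : ℕ} [NeZero n] [NeZero m] (hn : 3 ≤ n) (hm : 2 ≤ m)
    (δ : Fin m → ℝ) :
    (lapGp n m δ).charpoly = X * ((X - C 1) ^ (m - 2) *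
      (doubleCycleFactor n * secularPoly n m (∑ j, δ j) (δ 0))) := by
  have hmonic : (starQuadratic m).Monic := by
    unfold starQuadratic; monicity!
  have hne : (X - C 1) * starQuadratic m ≠ (0 : ℝ[X]) :=
    mul_ne_zero (X_sub_C_ne_zero 1) hmonic.ne_zero
  refine eq_of_infinite_eval_eq _ _ ((Set.Finite.infinite_compl
    ((X - C 1) * starQuadratic m).roots.toFinset.finite_toSet).mono fun x hx => ?_)
  simp only [Set.mem_compl_iff, Finset.mem_coe, Multiset.mem_toFinset, mem_roots hne, IsRoot.def,
    eval_mul, mul_eq_zero, not_or] at hx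
  have hx1 : x ≠ 1 := fun h => hx.1 (by simp [h])
  change eval x _ = eval x _
  rw [eval_charpoly_lapGp hn hm δ hx1 hx.2, det_cyclePencil_eq hn, adjugate_cyclePencil_eq hn]
  simp only [secularPoly, eval_mul, eval_sub, eval_add, eval_X, eval_C, eval_pow]
  ring

/-! ### The numbers `α` and `β` -/

theorem betaMinus_add_betaPlus (m : ℕ) : betaMinus m 1 + betaPlus m 1 = m + 1 := by
  rw [betaMinus, betaPlus]; ring

theorem betaMinus_mul_betaPlus (m : ℕ) (hm : 1 ≤ m) : betaMinus m 1 * betaPlus m 1 = 1 := by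
  have hm' : (1 : ℝ) ≤ m := by exact_mod_cast hm
  have h := Real.mul_self_sqrt (show 0 ≤ ((m : ℝ) + 1) ^ 2 - 4 * 1 by nlinarith)
  rw [betaMinus, betaPlus]
  linear_combination -(1 / 4) * h

theorem eval_starQuadratic {m : ℕ} (hm : 1 ≤ m) (x : ℝ) :
    (starQuadratic m).eval x = (x - betaMinus m 1) * (x - betaPlus m 1) := by
  simp only [starQuadratic, eval_add, eval_sub, eval_mul, eval_pow, eval_X, eval_C, eval_one]
  linear_combination x * betaMinus_add_betaPlus m - betaMinus_mul_betaPlus m hm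

theorem lt_betaPlus {m : ℕ} (hm : 2 ≤ m) : (m : ℝ) < betaPlus m 1 := by
  have hm' : (2 : ℝ) ≤ m := by exact_mod_cast hm
  rw [betaPlus]
  set s := √(((m : ℝ) + 1) ^ 2 - 4 * 1) with hs
  have h : (m : ℝ) - 1 < s := Real.lt_sqrt_of_sq_lt (by nlinarith)
  linarith

theorem betaMinus_pos {m : ℕ} (hm : 2 ≤ m) : 0 < betaMinus m 1 := by
  have hm' : (2 : ℝ) ≤ m := by exact_mod_cast hm
  have h1 := lt_betaPlus hm
  have h2 := betaMinus_mul_betaPlus m (by omega)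
  by_contra! h
  nlinarith

theorem betaMinus_lt_one {m : ℕ} (hm : 2 ≤ m) : betaMinus m 1 < 1 := by
  have h1 := lt_betaPlus hm
  have h2 := betaMinus_add_betaPlus m
  linarith

theorem alpha_nonneg (n l : ℕ) : 0 ≤ alpha n l := by
  have := Real.cos_le_one (l * Real.pi / n)
  rw [alpha]; linarith

theorem alpha_le_four (n l : ℕ) : alpha n l ≤ 4 := by
  have := Real.neg_one_le_cos (l * Real.pi / n)
  rw [alpha]; linarith

theorem alpha_lt {n i j : ℕ} (hij : i < j) (hj : j ≤ n) : alpha n i < alpha n j :=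
  alpha_strictMonoOn n (Set.mem_Iic.2 (hij.le.trans hj)) (Set.mem_Iic.2 hj) hij

theorem alpha_le {n i j : ℕ} (hij : i ≤ j) (hj : j ≤ n) : alpha n i ≤ alpha n j :=
  (alpha_strictMonoOn n).monotoneOn (Set.mem_Iic.2 (hij.trans hj)) (Set.mem_Iic.2 hj) hij

/-! ### Signs from interlacing -/

/-- Pairing `α_{2k+1}` with `α_{2k+2}`, both factors have the same sign at `α_{2i+1}` unless
`k = i`. -/
theorem evenCycleFactor_mul_derivative_oddPathFactor_neg {n i : ℕ} (hi : i < n / 2) :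
    (evenCycleFactor n).eval (alpha n (2 * i + 1)) *
      (derivative (oddPathFactor n)).eval (alpha n (2 * i + 1)) < 0 := by
  have hmem : i ∈ Finset.range (n / 2) := Finset.mem_range.2 hi
  have hT : (derivative (oddPathFactor n)).eval (alpha n (2 * i + 1)) =
      ∏ k ∈ (Finset.range (n / 2)).erase i, (alpha n (2 * i + 1) - alpha n (2 * k + 1)) := by
    rw [oddPathFactor, Lagrange.eval_nodal_derivative_eval_node_eq
      (v := fun k => alpha n (2 * k + 1)) hmem, Lagrange.eval_nodal]
  rw [hT, evenCycleFactor, eval_prod, ← Finset.mul_prod_erase _ _ hmem, mul_assoc,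
    ← Finset.prod_mul_distrib]
  refine mul_neg_of_neg_of_pos ?_ (Finset.prod_pos fun k hk => ?_)
  · simpa using alpha_lt (n := n) (show 2 * i + 1 < 2 * i + 2 by omega) (by omega)
  · simp only [Finset.mem_erase, Finset.mem_range] at hk
    simp only [eval_sub, eval_X, eval_C]
    rcases lt_or_gt_of_ne hk.1 with h | h
    · exact mul_pos (sub_pos.2 (alpha_lt (by omega) (by omega)))
        (sub_pos.2 (alpha_lt (by omega) (by omega)))
    · exact mul_pos_of_neg_of_neg (sub_neg.2 (alpha_lt (by omega) (by omega)))
        (sub_neg.2 (alpha_lt (by omega) (by omega)))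

theorem evenCycleFactor_mul_oddPathFactor_neg {n : ℕ} (hn : 2 ≤ n) {c : ℝ} (h₁ : alpha n 1 < c)
    (h₂ : c ≤ alpha n 2) :
    (evenCycleFactor n).eval (alpha n 1) * (oddPathFactor n).eval c < 0 := by
  have hmem : 0 ∈ Finset.range (n / 2) := Finset.mem_range.2 (by omega)
  rw [oddPathFactor, Lagrange.eval_nodal, evenCycleFactor, eval_prod, ← Finset.prod_mul_distrib,
    ← Finset.mul_prod_erase _ _ hmem]
  refine mul_neg_of_neg_of_pos ?_ (Finset.prod_pos fun k hk => ?_)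
  · simp only [eval_sub, eval_X, eval_C, mul_zero, zero_add]
    exact mul_neg_of_neg_of_pos (sub_neg.2 (alpha_lt (by omega) (by omega))) (sub_pos.2 h₁)
  · simp only [Finset.mem_erase, Finset.mem_range] at hk
    simp only [eval_sub, eval_X, eval_C]
    exact mul_pos_of_neg_of_neg (sub_neg.2 (alpha_lt (by omega) (by omega)))
      (sub_neg.2 (h₂.trans_lt (alpha_lt (by omega) (by omega))))

theorem eval_secularPoly (n m : ℕ) (d d₀ x : ℝ) :
    (secularPoly n m d d₀).eval x = (evenCycleFactor n).eval x * (starQuadratic m).eval x -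
      (oddPathFactor n).eval x * (d * (x - (m + 1)) + d₀) := by
  simp [secularPoly]

theorem starQuadratic_monic (m : ℕ) : (starQuadratic m).Monic := by
  unfold starQuadratic; monicity!

theorem evenCycleFactor_monic (n : ℕ) : (evenCycleFactor n).Monic :=
  monic_prod_X_sub_C (fun k => alpha n (2 * k + 2)) _

theorem secularPoly_monic_and_natDegree (n m : ℕ) (d d₀ : ℝ) :
    (secularPoly n m d d₀).Monic ∧ (secularPoly n m d d₀).natDegree = n / 2 + 2 := by
  have hS : (evenCycleFactor n).natDegree = n / 2 := by
    rw [evenCycleFactor, natDegree_finsetProd_X_sub_C_eq_card, Finset.card_range]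
  have hB : (starQuadratic m).natDegree = 2 := by
    unfold starQuadratic; compute_degree!
  have hmonic := (evenCycleFactor_monic n).mul (starQuadratic_monic m)
  have hdeg : (evenCycleFactor n * starQuadratic m).natDegree = n / 2 + 2 := by
    rw [(evenCycleFactor_monic n).natDegree_mul (starQuadratic_monic m), hS, hB]
  have hlt : (oddPathFactor n * (C d * (X - C (m + 1 : ℝ)) + C d₀)).natDegree <
      (evenCycleFactor n * starQuadratic m).natDegree := by
    rw [hdeg]
    refine natDegree_mul_le.trans_lt ?_
    have h1 : (oddPathFactor n).natDegree = n / 2 := by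
      rw [oddPathFactor, Lagrange.natDegree_nodal, Finset.card_range]
    have h2 : (C d * (X - C (m + 1 : ℝ)) + C d₀).natDegree ≤ 1 := by compute_degree
    omega
  exact ⟨hmonic.sub_of_left (degree_lt_degree hlt),
    by rw [secularPoly, natDegree_sub_eq_left_of_natDegree_lt hlt, hdeg]⟩

/-! ### The roots of the secular polynomial -/

/-- Off the real line, and below both `β⁻` and `α₁`, the secular polynomial has no zeros, provided
that it is negative at some point `x₀` of the interval `(4, β⁺]`. The nodes are `β⁻`, `x₀` and the odd
`α`'s; the hypothesis on `β⁻` makes them distinct. -/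
theorem secularPoly_roots_real {n m : ℕ} (hm : 4 ≤ m)
    (hβ : ∀ l : ℕ, l < n → betaMinus m 1 ≠ alpha n l) {d d₀ x₀ : ℝ} (hd : 0 < d) (hd₀ : d₀ ≤ d)
    (hx₀ : 4 < x₀) (hx₀' : x₀ ≤ betaPlus m 1) (hF : (secularPoly n m d d₀).eval x₀ < 0)
    {z : ℂ} (hz : aeval z (secularPoly n m d d₀) = 0) :
    z.im = 0 ∧ min (betaMinus m 1) (alpha n 1) < z.re := by
  have hm4 : (4 : ℝ) ≤ m := by exact_mod_cast hm
  have hβ1 := betaMinus_lt_one (m := m) (by omega)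
  have hβm := lt_betaPlus (m := m) (by omega)
  set β := betaMinus m 1
  set a : ℕ → ℝ := fun k => alpha n (2 * k + 1) with ha
  have haβ : ∀ k < n / 2, a k ≠ β := fun k hk => (hβ _ (by omega)).symm
  have haInj : Set.InjOn a (Finset.range (n / 2)) := by
    intro i hi j hj hij
    simp only [Finset.coe_range, Set.mem_Iio] at hi hj
    have := (alpha_strictMonoOn n).injOn (x₁ := 2 * i + 1) (x₂ := 2 * j + 1)
      (by simp; omega) (by simp; omega) hij
    omega
  have hx₀mem : x₀ ∉ (Finset.range (n / 2)).image a := by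
    simp only [Finset.mem_image, not_exists, not_and]
    intro k _ h
    have := alpha_le_four n (2 * k + 1)
    simp only [ha] at h
    linarith
  have hβmem : β ∉ insert x₀ ((Finset.range (n / 2)).image a) := by
    simp only [Finset.mem_insert, Finset.mem_image, Finset.mem_range, not_or, not_exists, not_and]
    exact ⟨by linarith, haβ⟩
  set Z : Finset ℝ := insert β (insert x₀ ((Finset.range (n / 2)).image a)) with hZ
  have hnodal : Lagrange.nodal Z id = (X - C β) * ((X - C x₀) * oddPathFactor n) := by
    rw [hZ, Lagrange.nodal_insert_eq_nodal hβmem, Lagrange.nodal_insert_eq_nodal hx₀mem,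
      Lagrange.nodal_eq ((Finset.range (n / 2)).image a), Finset.prod_image haInj,
      oddPathFactor, Lagrange.nodal_eq]
    rfl
  have hcard : (secularPoly n m d d₀).natDegree = Z.card := by
    rw [(secularPoly_monic_and_natDegree n m d d₀).2, hZ, Finset.card_insert_of_notMem hβmem,
      Finset.card_insert_of_notMem hx₀mem, Finset.card_image_of_injOn haInj, Finset.card_range]
  have hT : ∀ x, (∀ k < n / 2, x ≠ a k) → (oddPathFactor n).eval x ≠ 0 := by
    intro x hx
    rw [oddPathFactor, Lagrange.eval_nodal, Finset.prod_ne_zero_iff]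
    exact fun k hk => sub_ne_zero.2 (hx k (Finset.mem_range.1 hk))
  have hTpos : 0 < (oddPathFactor n).eval x₀ := by
    rw [oddPathFactor, Lagrange.eval_nodal]
    exact Finset.prod_pos fun k _ => by
      have := alpha_le_four n (2 * k + 1)
      linarith
  have hneg : ∀ t ∈ Z, (secularPoly n m d d₀).eval (id t) *
      (derivative (Lagrange.nodal Z id)).eval (id t) < 0 := by
    intro t ht
    rw [hnodal]
    simp only [derivative_mul, derivative_sub, derivative_X, derivative_C, sub_zero, one_mul,
      eval_add, eval_mul, eval_sub, eval_X, eval_C, id]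
    simp only [hZ, Finset.mem_insert, Finset.mem_image, Finset.mem_range] at ht
    rcases ht with rfl | rfl | ⟨k, hk, rfl⟩
    · rw [eval_secularPoly, eval_starQuadratic (by omega)]
      have h1 : d * (β - (m + 1)) + d₀ < 0 := by nlinarith
      have h2 := pow_pos (abs_pos.2 (hT β fun k hk => (haβ k hk).symm)) 2
      rw [sq_abs] at h2
      have h3 : β - x₀ < 0 := by linarith
      have h4 := mul_neg_of_pos_of_neg h2 h3
      have h5 := mul_pos_of_neg_of_neg h4 h1
      simp only [β] at h5 ⊢
      linarith
    · have h1 : 0 < (t - β) * (oddPathFactor n).eval t := mul_pos (by linarith) hTpos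
      have h2 := mul_neg_of_neg_of_pos hF h1
      linarith
    · have hTk : (oddPathFactor n).eval (a k) = 0 :=
        Lagrange.eval_nodal_at_node (v := a) (Finset.mem_range.2 hk)
      have hk4 : a k ≤ 4 := alpha_le_four n (2 * k + 1)
      rw [eval_secularPoly, eval_starQuadratic (by omega), hTk]
      have h1 : (evenCycleFactor n).eval (a k) * (derivative (oddPathFactor n)).eval (a k) < 0 :=
        evenCycleFactor_mul_derivative_oddPathFactor_neg hk
      have h2 := pow_pos (abs_pos.2 (sub_ne_zero.2 (haβ k hk))) 2
      rw [sq_abs] at h2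
      have h3 : 0 < (a k - betaPlus m 1) * (a k - x₀) :=
        mul_pos_of_neg_of_neg (by linarith) (by linarith)
      have h4 := mul_neg_of_neg_of_pos h1 (mul_pos h2 h3)
      simp only [β] at h4 ⊢
      linarith
  obtain ⟨him, t, ht, htz⟩ := im_eq_zero_of_eval_mul_derivative_nodal_neg
    (Function.injective_id.injOn) (secularPoly_monic_and_natDegree n m d d₀).1 hcard hneg hz
  refine ⟨him, lt_of_le_of_lt ?_ htz⟩
  simp only [hZ, Finset.mem_insert, Finset.mem_image, Finset.mem_range] at ht
  rcases ht with rfl | rfl | ⟨k, hk, rfl⟩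
  · exact min_le_left _ _
  · exact (min_le_left _ _).trans (by simp only [id]; linarith)
  · exact (min_le_right _ _).trans (alpha_le (by omega) (by omega))

/-- The sign change of the secular polynomial on `[α₁, min α₂ β⁻]`: at the left end `T` vanishes, at
the right end `S B` vanishes. -/
theorem exists_secularPoly_root {n m : ℕ} (hn : 3 ≤ n) (hm : 4 ≤ m) {d d₀ : ℝ} (hd : 0 < d)
    (hd₀ : d₀ ≤ d) (h : alpha n 1 < betaMinus m 1) :
    ∃ r, r < min (alpha n 2) (betaMinus m 1) ∧ (secularPoly n m d d₀).eval r = 0 := by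
  have hm4 : (4 : ℝ) ≤ m := by exact_mod_cast hm
  have hβ1 := betaMinus_lt_one (m := m) (by omega)
  have hβm := lt_betaPlus (m := m) (by omega)
  set c := min (alpha n 2) (betaMinus m 1) with hc
  have h1c : alpha n 1 < c := lt_min (alpha_lt (by omega) (by omega)) h
  have hcβ : c ≤ betaMinus m 1 := min_le_right _ _
  have hTα : (oddPathFactor n).eval (alpha n 1) = 0 :=
    Lagrange.eval_nodal_at_node (v := fun k => alpha n (2 * k + 1)) (i := 0)
      (Finset.mem_range.2 (by omega))
  have hSB : (evenCycleFactor n).eval c * (starQuadratic m).eval c = 0 := by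
    rcases min_choice (alpha n 2) (betaMinus m 1) with h' | h'
    · rw [hc, h', evenCycleFactor, eval_prod, Finset.prod_eq_zero (i := 0), zero_mul]
      · exact Finset.mem_range.2 (by omega)
      · simp
    · rw [hc, h', eval_starQuadratic (by omega), sub_self, zero_mul, mul_zero]
  have hB : 0 < (starQuadratic m).eval (alpha n 1) := by
    rw [eval_starQuadratic (by omega)]
    exact mul_pos_of_neg_of_neg (by linarith) (by linarith)
  have hg : d * (c - (m + 1)) + d₀ < 0 := by nlinarith
  have hprod : (secularPoly n m d d₀).eval (alpha n 1) * (secularPoly n m d d₀).eval c < 0 := by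
    rw [eval_secularPoly, eval_secularPoly, hSB, hTα]
    have := mul_neg_of_neg_of_pos (evenCycleFactor_mul_oddPathFactor_neg (by omega) h1c
      (min_le_left _ _)) (mul_pos hB (neg_pos.2 hg))
    linarith
  have hcont := (secularPoly n m d d₀).continuous.continuousOn (s := Set.Icc (alpha n 1) c)
  rcases mul_neg_iff.1 hprod with h' | h'
  · obtain ⟨r, hr, hr0⟩ := intermediate_value_Ioo' h1c.le hcont ⟨h'.2, h'.1⟩
    exact ⟨r, hr.2, hr0⟩
  · obtain ⟨r, hr, hr0⟩ := intermediate_value_Ioo h1c.le hcont h'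
    exact ⟨r, hr.2, hr0⟩

/-! ### Eigenvalues and spectral gaps -/

/-- The characteristic polynomial of the modified Laplacian, divided by the factor `X` that belongs to
the eigenvalue `0`. -/
noncomputable def nonzeroFactor (n m : ℕ) (d d₀ : ℝ) : ℝ[X] :=
  (X - C 1) ^ (m - 2) * (doubleCycleFactor n * secularPoly n m d d₀)

theorem nonzeroFactor_ne_zero (n m : ℕ) (d d₀ : ℝ) : nonzeroFactor n m d d₀ ≠ 0 :=
  (((monic_X_sub_C 1).pow _).mul ((monic_prod_X_sub_C (fun k => alpha n (2 * k + 2)) _).mul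
    (secularPoly_monic_and_natDegree n m d d₀).1)).ne_zero

theorem eigenvalueMultiset_lapGp {n m : ℕ} [NeZero n] [NeZero m] (hn : 3 ≤ n) (hm : 2 ≤ m)
    (δ : Fin m → ℝ) :
    eigenvalueMultiset (lapGp n m δ) = 0 ::ₘ (nonzeroFactor n m (∑ j, δ j) (δ 0)).aroots ℂ := by
  rw [eigenvalueMultiset, charpoly_lapGp hn hm, ← nonzeroFactor,
    aroots_mul (mul_ne_zero X_ne_zero (nonzeroFactor_ne_zero _ _ _ _)), aroots_X,
    Multiset.singleton_add]

theorem mem_aroots_nonzeroFactor {n m : ℕ} {d d₀ : ℝ} {z : ℂ}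
    (hz : z ∈ (nonzeroFactor n m d d₀).aroots ℂ) :
    z = 1 ∨ (∃ k < (n - 1) / 2, z = (alpha n (2 * k + 2) : ℝ)) ∨
      aeval z (secularPoly n m d d₀) = 0 := by
  have h := (mem_aroots.1 hz).2
  rw [nonzeroFactor, map_mul, map_mul, mul_eq_zero, mul_eq_zero] at h
  rcases h with h | h | h
  · left
    rw [map_pow] at h
    have := eq_zero_of_pow_eq_zero h
    simpa [sub_eq_zero] using this
  · right; left
    rw [doubleCycleFactor, map_prod, Finset.prod_eq_zero_iff] at h
    obtain ⟨k, hk, h⟩ := h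
    exact ⟨k, Finset.mem_range.1 hk, by simpa [sub_eq_zero] using h⟩
  · exact Or.inr (Or.inr h)

theorem mem_aroots_of_secularPoly_root {n m : ℕ} {d d₀ r : ℝ}
    (hr : (secularPoly n m d d₀).eval r = 0) :
    (r : ℂ) ∈ (nonzeroFactor n m d d₀).aroots ℂ := by
  refine mem_aroots.2 ⟨nonzeroFactor_ne_zero _ _ _ _, ?_⟩
  rw [← Complex.coe_algebraMap, aeval_algebraMap_apply, coe_aeval_eq_eval, nonzeroFactor, eval_mul,
    eval_mul, hr, mul_zero, mul_zero, map_zero]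

theorem lapG_eq (n m : ℕ) [NeZero n] [NeZero m] : lapG n m = lapGp n m 0 := by
  have : adjModification n m 0 = 0 := by
    ext (i | i) (j | j) <;> simp [adjModification]
  rw [lapG, lapGp, this, add_zero]

theorem secularPoly_zero (n m : ℕ) :
    secularPoly n m 0 0 = evenCycleFactor n * starQuadratic m := by
  simp [secularPoly]

theorem aroots_nonzeroFactor_zero {n m : ℕ} (hn : 3 ≤ n) (hm : 4 ≤ m) {z : ℂ}
    (hz : z ∈ (nonzeroFactor n m 0 0).aroots ℂ) :
    z.im = 0 ∧ min (alpha n 2) (betaMinus m 1) ≤ z.re := by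
  have hm4 : (4 : ℝ) ≤ m := by exact_mod_cast hm
  have hβ1 := betaMinus_lt_one (m := m) (by omega)
  have hβm := lt_betaPlus (m := m) (by omega)
  rcases mem_aroots_nonzeroFactor hz with rfl | ⟨k, hk, rfl⟩ | h
  · exact ⟨rfl, (min_le_right _ _).trans hβ1.le⟩
  · exact ⟨rfl, (min_le_left _ _).trans (alpha_le (by omega) (by omega))⟩
  · rw [secularPoly_zero, map_mul, mul_eq_zero] at h
    rcases h with h | h
    · rw [evenCycleFactor, map_prod, Finset.prod_eq_zero_iff] at h
      obtain ⟨k, hk, h⟩ := h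
      have hz : z = (alpha n (2 * k + 2) : ℝ) := by simpa [sub_eq_zero] using h
      rw [Finset.mem_range] at hk
      subst hz
      exact ⟨rfl, (min_le_left _ _).trans (alpha_le (by omega) (by omega))⟩
    · have hB : starQuadratic m = (X - C (betaMinus m 1)) * (X - C (betaPlus m 1)) :=
        Polynomial.funext fun x => by rw [eval_starQuadratic (by omega)]; simp
      rw [hB, map_mul, mul_eq_zero] at h
      rcases h with h | h
      · have hz : z = (betaMinus m 1 : ℝ) := by simpa [sub_eq_zero] using h
        subst hz
        exact ⟨rfl, min_le_right _ _⟩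
      · have hz : z = (betaPlus m 1 : ℝ) := by simpa [sub_eq_zero] using h
        subst hz
        exact ⟨rfl, (min_le_right _ _).trans (by simp only [Complex.ofReal_re]; linarith)⟩

theorem eigenvalueMultiset_lapG {n m : ℕ} [NeZero n] [NeZero m] (hn : 3 ≤ n) (hm : 2 ≤ m) :
    eigenvalueMultiset (lapG n m) = 0 ::ₘ (nonzeroFactor n m 0 0).aroots ℂ := by
  rw [lapG_eq, eigenvalueMultiset_lapGp hn hm]
  simp

theorem allEigenvaluesReal_lapG {n m : ℕ} [NeZero n] [NeZero m] (hn : 3 ≤ n) (hm : 4 ≤ m) :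
    AllEigenvaluesReal (lapG n m) := by
  intro z hz
  rw [eigenvalueMultiset_lapG hn (by omega), Multiset.mem_cons] at hz
  rcases hz with rfl | hz
  · rfl
  · exact (aroots_nonzeroFactor_zero hn hm hz).1

theorem reLambda₂_lapG {n m : ℕ} [NeZero n] [NeZero m] (hn : 3 ≤ n) (hm : 4 ≤ m) :
    reLambda₂ (lapG n m) = min (alpha n 2) (betaMinus m 1) := by
  rw [reLambda₂, eigenvalueMultiset_lapG hn (by omega), Multiset.map_cons, Complex.zero_re]
  refine Multiset.sort_getD_one_eq ?_ ?_ ?_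
  · exact le_min (alpha_nonneg n 2) (betaMinus_pos (by omega)).le
  · refine Multiset.mem_map.2 ⟨_, mem_aroots_of_secularPoly_root
      (r := min (alpha n 2) (betaMinus m 1)) ?_, Complex.ofReal_re _⟩
    rw [secularPoly_zero, eval_mul]
    rcases min_choice (alpha n 2) (betaMinus m 1) with h' | h'
    · rw [h', evenCycleFactor, eval_prod, Finset.prod_eq_zero (i := 0), zero_mul]
      · exact Finset.mem_range.2 (by omega)
      · simp
    · rw [h', eval_starQuadratic (by omega), sub_self, zero_mul, mul_zero]
  · intro b hb
    obtain ⟨z, hz, rfl⟩ := Multiset.mem_map.1 hb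
    exact (aroots_nonzeroFactor_zero hn hm hz).2

theorem reLambda₂_lapGp_lt {n m : ℕ} [NeZero n] [NeZero m] (hn : 3 ≤ n) (hm : 4 ≤ m)
    {δ : Fin m → ℝ} (hδ : ∀ i, 0 ≤ δ i) (hδ0 : δ ≠ 0) (h : alpha n 1 < betaMinus m 1) :
    reLambda₂ (lapGp n m δ) < reLambda₂ (lapG n m) := by
  have hd : 0 < ∑ i, δ i := Fintype.sum_pos (lt_of_le_of_ne hδ hδ0.symm)
  have hd₀ : δ 0 ≤ ∑ i, δ i := Finset.single_le_sum (fun i _ => hδ i) (Finset.mem_univ 0)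
  obtain ⟨r, hrc, hr⟩ := exists_secularPoly_root hn hm hd hd₀ h
  rw [reLambda₂_lapG hn hm, reLambda₂, eigenvalueMultiset_lapGp hn (by omega), Multiset.map_cons,
    Complex.zero_re]
  refine Multiset.sort_getD_one_lt (a := 0) (b := r) ?_ ?_ hrc
  · refine Multiset.cons_le_cons _ (Multiset.singleton_le.2 ?_)
    exact Multiset.mem_map.2 ⟨_, mem_aroots_of_secularPoly_root hr, Complex.ofReal_re _⟩
  · exact lt_min ((alpha_nonneg n 1).trans_lt (alpha_lt (by omega) (by omega)))
      (betaMinus_pos (by omega))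

theorem allEigenvaluesReal_lapGp_and_lt {n m : ℕ} [NeZero n] [NeZero m] (hn : 3 ≤ n) (hm : 4 ≤ m)
    (hβ : ∀ l : ℕ, l < n → betaMinus m 1 ≠ alpha n l)
    {δ : Fin m → ℝ} (hδ : ∀ i, 0 ≤ δ i) (hδ0 : δ ≠ 0) {x₀ : ℝ}
    (hx₀ : 4 < x₀) (hx₀' : x₀ ≤ betaPlus m 1)
    (hF : (secularPoly n m (∑ i, δ i) (δ 0)).eval x₀ < 0) :
    AllEigenvaluesReal (lapGp n m δ) ∧
      (betaMinus m 1 < alpha n 1 → reLambda₂ (lapG n m) < reLambda₂ (lapGp n m δ)) := by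
  have hd : 0 < ∑ i, δ i := Fintype.sum_pos (lt_of_le_of_ne hδ hδ0.symm)
  have hd₀ : δ 0 ≤ ∑ i, δ i := Finset.single_le_sum (fun i _ => hδ i) (Finset.mem_univ 0)
  have hroots : ∀ z ∈ (nonzeroFactor n m (∑ i, δ i) (δ 0)).aroots ℂ,
      z.im = 0 ∧ (betaMinus m 1 < alpha n 1 → betaMinus m 1 < z.re) := by
    intro z hz
    have hβ1 := betaMinus_lt_one (m := m) (by omega)
    rcases mem_aroots_nonzeroFactor hz with rfl | ⟨k, hk, rfl⟩ | h
    · exact ⟨rfl, fun _ => hβ1⟩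
    · have : alpha n 1 < alpha n (2 * k + 2) := alpha_lt (by omega) (by omega)
      exact ⟨rfl, fun h => h.trans this⟩
    · have := secularPoly_roots_real hm hβ hd hd₀ hx₀ hx₀' hF h
      exact ⟨this.1, fun h => by rw [min_eq_left h.le] at this; exact this.2⟩
  refine ⟨fun z hz => ?_, fun h => ?_⟩
  · rw [eigenvalueMultiset_lapGp hn (by omega), Multiset.mem_cons] at hz
    rcases hz with rfl | hz
    · rfl
    · exact (hroots z hz).1
  · have hα : alpha n 1 < alpha n 2 := alpha_lt (by omega) (by omega)
    rw [reLambda₂_lapG hn hm, min_eq_right (h.trans hα).le, reLambda₂,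
      eigenvalueMultiset_lapGp hn (by omega), Multiset.map_cons, Complex.zero_re]
    have hle : ∀ b ∈ ((nonzeroFactor n m (∑ i, δ i) (δ 0)).aroots ℂ).map Complex.re, 0 ≤ b := by
      intro b hb
      obtain ⟨z, hz, rfl⟩ := Multiset.mem_map.1 hb
      exact (betaMinus_pos (m := m) (by omega)).le.trans ((hroots z hz).2 h).le
    have hne : ((nonzeroFactor n m (∑ i, δ i) (δ 0)).aroots ℂ).map Complex.re ≠ 0 := by
      have hmem : (1 : ℂ) ∈ (nonzeroFactor n m (∑ i, δ i) (δ 0)).aroots ℂ := by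
        refine mem_aroots.2 ⟨nonzeroFactor_ne_zero _ _ _ _, ?_⟩
        simp [nonzeroFactor, show m - 2 ≠ 0 by omega]
      exact fun h0 => Multiset.notMem_zero _ (h0 ▸ Multiset.mem_map_of_mem Complex.re hmem)
    obtain ⟨z, hz, hzre⟩ := Multiset.mem_map.1 (Multiset.sort_getD_one_cons hle hne)
    rw [← hzre]
    exact (hroots z hz).2 h

/-! ### Points where the secular polynomial is negative -/

theorem secularPoly_neg_at_betaPlus {n m : ℕ} (hm : 4 ≤ m) {d d₀ : ℝ}
    (h : d < d₀ * betaPlus m 1) : (secularPoly n m d d₀).eval (betaPlus m 1) < 0 := by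
  have hm4 : (4 : ℝ) ≤ m := by exact_mod_cast hm
  have hβ0 := betaMinus_pos (m := m) (by omega)
  have hβm := lt_betaPlus (m := m) (by omega)
  have hsum := betaMinus_add_betaPlus m
  have hmul := betaMinus_mul_betaPlus m (by omega)
  have hT : 0 < (oddPathFactor n).eval (betaPlus m 1) := by
    rw [oddPathFactor, Lagrange.eval_nodal]
    exact Finset.prod_pos fun k _ => by
      have := alpha_le_four n (2 * k + 1)
      linarith
  have hg : 0 < d * (betaPlus m 1 - (m + 1)) + d₀ := by
    rw [show betaPlus m 1 - (m + 1) = - betaMinus m 1 by linarith]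
    have h' := mul_lt_mul_of_pos_right h hβ0
    rw [mul_assoc, mul_comm (betaPlus m 1), hmul] at h'
    linarith
  rw [eval_secularPoly, eval_starQuadratic (by omega), sub_self, mul_zero, mul_zero, zero_sub]
  exact neg_neg_of_pos (mul_pos hT hg)

/-- At the midpoint of `4` and `β⁺` the unperturbed polynomial `S B` is negative, and the perturbation
is at most `d (m + 1) T`. -/
theorem exists_secularPoly_neg_of_small {n m : ℕ} (hm : 4 ≤ m) :
    ∃ ε : ℝ, 0 < ε ∧ ∀ d d₀ : ℝ, 0 ≤ d₀ → 0 ≤ d → d < ε →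
      (secularPoly n m d d₀).eval ((4 + betaPlus m 1) / 2) < 0 := by
  have hm4 : (4 : ℝ) ≤ m := by exact_mod_cast hm
  have hβ1 := betaMinus_lt_one (m := m) (by omega)
  have hβm := lt_betaPlus (m := m) (by omega)
  set x := (4 + betaPlus m 1) / 2 with hx
  have hpos : ∀ l, 0 < x - alpha n l := fun l => by
    have := alpha_le_four n l
    linarith
  have hT : 0 < (oddPathFactor n).eval x := by
    rw [oddPathFactor, Lagrange.eval_nodal]
    exact Finset.prod_pos fun k _ => hpos _
  have hS : 0 < (evenCycleFactor n).eval x := by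
    rw [evenCycleFactor, eval_prod]
    exact Finset.prod_pos fun k _ => by simpa using hpos (2 * k + 2)
  have hB : (starQuadratic m).eval x < 0 := by
    rw [eval_starQuadratic (by omega)]
    exact mul_neg_of_pos_of_neg (by linarith) (by linarith)
  have hSB := mul_neg_of_pos_of_neg hS hB
  have hTm : 0 < (oddPathFactor n).eval x * (m + 1) := by positivity
  refine ⟨-((evenCycleFactor n).eval x * (starQuadratic m).eval x) /
    ((oddPathFactor n).eval x * (m + 1)), div_pos (neg_pos.2 hSB) hTm, fun d d₀ hd₀ hd hε => ?_⟩
  rw [lt_div_iff₀ hTm] at hε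
  rw [eval_secularPoly]
  have h1 : 0 ≤ (oddPathFactor n).eval x * (d * x + d₀) :=
    mul_nonneg hT.le (add_nonneg (mul_nonneg hd (by linarith)) hd₀)
  linarith

theorem theoremB (n m : ℕ) [NeZero n] [NeZero m] (hn : 3 ≤ n) (hm : 4 ≤ m)
    (hβ : ∀ l : ℕ, l < n → betaMinus m 1 ≠ alpha n l) :
    -- the eigenvalues of the unmodified Laplacian are real, so `λ₂(L_G) = Re λ₂(L_G)`
    AllEigenvaluesReal (lapG n m) ∧
    -- local modification
    (∃ ε : ℝ, 0 < ε ∧ ∀ δ : Fin m → ℝ, (∀ i, 0 ≤ δ i) → δ ≠ 0 → ∑ i, δ i < ε →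
      AllEigenvaluesReal (lapGp n m δ) ∧
      (alpha n 1 < betaMinus m 1 → reLambda₂ (lapGp n m δ) < reLambda₂ (lapG n m)) ∧
      (betaMinus m 1 < alpha n 1 → reLambda₂ (lapG n m) < reLambda₂ (lapGp n m δ))) ∧
    -- global modification
    (∀ δ : Fin m → ℝ, (∀ i, 0 ≤ δ i) → δ ≠ 0 →
      (alpha n 2 < betaMinus m 1 → reLambda₂ (lapGp n m δ) < reLambda₂ (lapG n m)) ∧
      (∑ i, δ i < δ 0 * betaPlus m 1 →
        AllEigenvaluesReal (lapGp n m δ) ∧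
        (alpha n 1 < betaMinus m 1 → reLambda₂ (lapGp n m δ) < reLambda₂ (lapG n m)) ∧
        (betaMinus m 1 < alpha n 1 → reLambda₂ (lapG n m) < reLambda₂ (lapGp n m δ)))) := by

  have hm4 : (4 : ℝ) ≤ m := by exact_mod_cast hm
  have hβm := lt_betaPlus (m := m) (by omega)
  refine ⟨allEigenvaluesReal_lapG hn hm, ?_, fun δ hδ hδ0 => ⟨fun h => ?_, fun h => ?_⟩⟩
  · obtain ⟨ε, hε, hsmall⟩ := exists_secularPoly_neg_of_small (n := n) hm
    refine ⟨ε, hε, fun δ hδ hδ0 hlt => ?_⟩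
    have hF := hsmall _ (δ 0) (hδ 0) (Finset.sum_nonneg fun i _ => hδ i) hlt
    have := allEigenvaluesReal_lapGp_and_lt hn hm hβ hδ hδ0 (by linarith) (by linarith) hF
    exact ⟨this.1, reLambda₂_lapGp_lt hn hm hδ hδ0, this.2⟩
  · exact reLambda₂_lapGp_lt hn hm hδ hδ0 ((alpha_lt (by omega) (by omega)).trans h)
  · have := allEigenvaluesReal_lapGp_and_lt hn hm hβ hδ hδ0 (by linarith) le_rfl
      (secularPoly_neg_at_betaPlus hm h)
    exact ⟨this.1, reLambda₂_lapGp_lt hn hm hδ hδ0, this.2⟩
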